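/- Let $H_1$ and $H_2$ be infinite-dimensional separable complex Hilbert spaces, and let $A : H_2 \to H_1$ and $B : H_1 \to H_2$ be bounded linear operators. A bounded operator $T : H \to K$ between complex Hilbert spaces is called *absolutely norm attaining* ($\mathcal{AN}$) if for every non-zero closed subspace $M \subseteq H$ there is a unit vector $x \in M$ with $\|Tx\| = \|T|_M\|$. Write $|T| = (T^*T)^{1/2}$ for the modulus of $T$, a positive operator on $H$. For a bounded operator $S$ on $H$ let $$\sigma_{ess}(S) = \{\mu \in \mathbb{C} : S - \mu I \text{ is not Fredholm}\},$$ where an operator is Fredholm if its range is closed and its kernel and the kernel of its adjoint are finite-dimensional. Then the operator $$T = \begin{bmatrix} 0 & A \\ B & 0 \end{bmatrix}, \qquad T(x_1, x_2) = (A x_2, B x_1),$$ on the Hilbert space direct sum $H_1 \oplus H_2$ is $\mathcal{AN}$ if and only if $A$ is $\mathcal{AN}$, $B$ is $\mathcal{AN}$, and $\sigma_{ess}(|A|) = \sigma_{ess}(|B|)$. -/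

import Mathlib

noncomputable section

open ContinuousLinearMap

namespace OffDiagonalAN

section Operators

variable {H K : Type*}
  [NormedAddCommGroup H] [InnerProductSpace ℂ H]
  [NormedAddCommGroup K] [InnerProductSpace ℂ K]

/-- A bounded operator is norm attaining if its norm is attained at some unit vector. -/
def IsNormAttaining (T : H →L[ℂ] K) : Prop :=
  ∃ x : H, ‖x‖ = 1 ∧ ‖T x‖ = ‖T‖

/-- A bounded operator is absolutely norm attaining (`AN`) if its restriction to every nonzero
closed subspace is norm attaining. -/
def IsAN (T : H →L[ℂ] K) : Prop :=
  ∀ M : Submodule ℂ H, IsClosed (M : Set H) → M ≠ ⊥ → IsNormAttaining (T ∘L M.subtypeL)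

/-- The essential spectrum: all `μ` such that `T - μ I` is not a Fredholm operator. -/
def essSpectrum (T : H →L[ℂ] H) : Set ℂ :=
  {μ : ℂ | ¬ (T - μ • ContinuousLinearMap.id ℂ H).IsFredholm}

/-- The modulus `|T| = (T* T)^(1/2)`, a positive operator on the domain of `T`. -/
def modulus [CompleteSpace H] [CompleteSpace K] (T : H →L[ℂ] K) : H →L[ℂ] H :=
  CFC.sqrt (adjoint T ∘L T)

/-- On Hilbert spaces, Fredholm means: closed range, and finite-dimensional kernels of the operator
and of its adjoint. -/
theorem isFredholm_iff [CompleteSpace H] [CompleteSpace K] (T : H →L[ℂ] K) :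
    T.IsFredholm ↔ IsClosed (Set.range T) ∧ FiniteDimensional ℂ T.ker ∧
      FiniteDimensional ℂ (adjoint T).ker := by
  have key : ∀ h : IsClosed (T.range : Set K),
      T.range.CoFG ↔ FiniteDimensional ℂ (adjoint T).ker := by
    intro h
    have : CompleteSpace T.range := h.completeSpace_coe
    have hc : IsCompl T.range (adjoint T).ker := by
      rw [← ContinuousLinearMap.orthogonal_range]
      exact T.range.isCompl_orthogonal
    rw [← Submodule.fg_iff_finiteDimensional]
    exact ⟨fun hf => hf.fg_of_isCompl hc, fun hf => hf.cofg_of_isCompl hc.symm⟩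
  constructor
  · intro hT
    exact ⟨hT.isClosed_range, hT.finite_ker, (key hT.isClosed_range).1 hT.finite_coker⟩
  · rintro ⟨h1, h2, h3⟩
    have h1' : IsClosed (T.range : Set K) := h1
    refine ⟨?_, h1', h2, (key h1').2 h3, ?_⟩
    · have : CompleteSpace T.range := h1'.completeSpace_coe
      let S : H →L[ℂ] T.range := T.rangeRestrict
      have hS : Function.Surjective S := LinearMap.surjective_rangeRestrict (T : H →ₗ[ℂ] K)
      exact (S.isOpenMap hS).isQuotientMap S.continuous hS
    · exact Submodule.ClosedComplemented.of_finiteDimensional _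

theorem modulus_nonneg [CompleteSpace H] [CompleteSpace K] (T : H →L[ℂ] K) :
    0 ≤ modulus T :=
  CFC.sqrt_nonneg _

theorem modulus_comp_modulus [CompleteSpace H] [CompleteSpace K] (T : H →L[ℂ] K) :
    modulus T ∘L modulus T = adjoint T ∘L T :=
  CFC.sqrt_mul_sqrt_self _ ((nonneg_iff_isPositive _).2 (isPositive_adjoint_comp_self T))

end Operators

section Block

variable {H₁ H₂ : Type*}
  [NormedAddCommGroup H₁] [InnerProductSpace ℂ H₁]
  [NormedAddCommGroup H₂] [InnerProductSpace ℂ H₂]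

/-- The operator on the Hilbert space direct sum `H₁ ⊕ H₂` given by the block matrix
`[[A₁₁, A₁₂], [A₂₁, A₂₂]]`. -/
def blockOperator (A₁₁ : H₁ →L[ℂ] H₁) (A₁₂ : H₂ →L[ℂ] H₁)
    (A₂₁ : H₁ →L[ℂ] H₂) (A₂₂ : H₂ →L[ℂ] H₂) :
    WithLp 2 (H₁ × H₂) →L[ℂ] WithLp 2 (H₁ × H₂) :=
  (WithLp.prodContinuousLinearEquiv 2 ℂ H₁ H₂).symm.toContinuousLinearMap ∘L
    ((A₁₁.coprod A₁₂).prod (A₂₁.coprod A₂₂)) ∘L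
      (WithLp.prodContinuousLinearEquiv 2 ℂ H₁ H₂).toContinuousLinearMap

theorem blockOperator_apply (A₁₁ : H₁ →L[ℂ] H₁) (A₁₂ : H₂ →L[ℂ] H₁)
    (A₂₁ : H₁ →L[ℂ] H₂) (A₂₂ : H₂ →L[ℂ] H₂) (x₁ : H₁) (x₂ : H₂) :
    blockOperator A₁₁ A₁₂ A₂₁ A₂₂ (WithLp.toLp 2 (x₁, x₂)) =
      WithLp.toLp 2 (A₁₁ x₁ + A₁₂ x₂, A₂₁ x₁ + A₂₂ x₂) :=
  rfl

end Block

end OffDiagonalAN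

end

noncomputable section

open ContinuousLinearMap
open scoped InnerProductSpace

namespace OffDiagonalAN

/-! ### Pythagoras for orthogonal series. -/

section Sequences

variable {H : Type*} [NormedAddCommGroup H] [InnerProductSpace ℂ H]

/-! `T` is AN exactly when `T* T` is a scalar `α` plus a positive compact operator minus a positive
finite-rank one. `IsEssScalar T α` states this through the form `‖T x‖ ^ 2`, so that no spectral
theorem is needed.

The condition passes to closed subspaces and forces the norm to be attained (`IsEssScalar.isAN`).
Conversely (`IsAN.exists_isEssScalar`), let `α` be the infimum of the upper bounds of the form on
subspaces of finite codimension. If infinitely many dimensions lay below `α`, there would be an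
orthonormal sequence with orthogonal images of strictly increasing norm, and the norm would not be
attained on its closed span.

In infinite dimension `α` is read off from `|T|`, whose essential spectrum is `{√α}`
(`IsEssScalar.essSpectrum_modulus`). The form of the block operator is the orthogonal sum of those
of `A` and `B`, so it is essentially the scalar `α` iff both are, with the same `α`. -/

theorem hasSum_norm_sq_of_pairwise_orthogonal {y : ℕ → H} (hy : Pairwise fun m n => ⟪y m, y n⟫_ℂ = 0)
    {c : ℕ → ℂ} {z : H} (hz : HasSum (fun n => c n • y n) z) :
    HasSum (fun n => ‖c n‖ ^ 2 * ‖y n‖ ^ 2) (‖z‖ ^ 2) := by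
  have h1 : ∀ n, ⟪y n, z⟫_ℂ = c n * (‖y n‖ : ℂ) ^ 2 := by
    intro n
    have h2 : HasSum (fun m => ⟪y n, c m • y m⟫_ℂ) ⟪y n, z⟫_ℂ := hz.mapL (innerSL ℂ (y n))
    have h3 : HasSum (fun m => ⟪y n, c m • y m⟫_ℂ) ⟪y n, c n • y n⟫_ℂ := by
      refine hasSum_single n fun m hm => ?_
      rw [inner_smul_right, hy hm.symm, mul_zero]
    rw [h2.unique h3, inner_smul_right, inner_self_eq_norm_sq_to_K]
    rfl
  have h4 : HasSum (fun n => ⟪z, c n • y n⟫_ℂ) ⟪z, z⟫_ℂ := hz.mapL (innerSL ℂ z)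
  have h5 := h4.mapL Complex.reCLM
  have h6 : Complex.reCLM ⟪z, z⟫_ℂ = ‖z‖ ^ 2 := inner_self_eq_norm_sq (𝕜 := ℂ) z
  rw [h6] at h5
  convert h5 using 2 with n
  have h7 : ⟪z, c n • y n⟫_ℂ = ((‖c n‖ ^ 2 * ‖y n‖ ^ 2 : ℝ) : ℂ) := by
    rw [inner_smul_right, ← inner_conj_symm, h1 n, map_mul, ← mul_assoc, Complex.mul_conj,
      Complex.normSq_eq_norm_sq]
    simp
  rw [h7]
  rfl

end Sequences

/-! ### AN operators as those with essentially scalar `T* T`. -/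

section EssScalar

variable {H K L : Type*}
  [NormedAddCommGroup H] [InnerProductSpace ℂ H]
  [NormedAddCommGroup K] [InnerProductSpace ℂ K]
  [NormedAddCommGroup L] [InnerProductSpace ℂ L]

/-- `T* T - α` has finite-rank negative part and compact positive part, expressed through the
quadratic form `‖T x‖ ^ 2 - α * ‖x‖ ^ 2` on orthogonal complements of finite-dimensional
subspaces. -/
structure IsEssScalar (T : H →L[ℂ] K) (α : ℝ) : Prop where
  exists_le : ∃ F : Submodule ℂ H, FiniteDimensional ℂ F ∧ ∀ x ∈ Fᗮ, α * ‖x‖ ^ 2 ≤ ‖T x‖ ^ 2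
  exists_ge : ∀ ε > 0, ∃ F : Submodule ℂ H, FiniteDimensional ℂ F ∧
    ∀ x ∈ Fᗮ, ‖T x‖ ^ 2 ≤ (α + ε) * ‖x‖ ^ 2

theorem mem_orthogonal_map_adjoint [CompleteSpace H] [CompleteSpace L] (J : L →L[ℂ] H)
    (F : Submodule ℂ H) {x : L} (hx : x ∈ (F.map (adjoint J : H →ₗ[ℂ] L))ᗮ) : J x ∈ Fᗮ := by
  rw [Submodule.mem_orthogonal] at hx ⊢
  intro u hu
  rw [← adjoint_inner_left]
  exact hx _ (Submodule.mem_map_of_mem hu)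

/-- Pulling `F` back to `J* F` keeps finite dimension. This serves both for restriction to closed
subspaces and for the two summands of the block operator. -/
theorem IsEssScalar.comp_isometry [CompleteSpace H] [CompleteSpace L] {T : H →L[ℂ] K} {α : ℝ}
    (h : IsEssScalar T α) (J : L →L[ℂ] H) (hJ : ∀ x, ‖J x‖ = ‖x‖) : IsEssScalar (T ∘L J) α := by
  constructor
  · obtain ⟨F, hF, h1⟩ := h.exists_le
    refine ⟨F.map (adjoint J : H →ₗ[ℂ] L), inferInstance, fun x hx => ?_⟩
    simpa [hJ] using h1 _ (mem_orthogonal_map_adjoint J F hx)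
  · intro ε hε
    obtain ⟨F, hF, h1⟩ := h.exists_ge ε hε
    refine ⟨F.map (adjoint J : H →ₗ[ℂ] L), inferInstance, fun x hx => ?_⟩
    simpa [hJ] using h1 _ (mem_orthogonal_map_adjoint J F hx)

theorem IsEssScalar.congr_norm {T : H →L[ℂ] K} {S : H →L[ℂ] L} {α : ℝ}
    (h : IsEssScalar T α) (hTS : ∀ x, ‖S x‖ = ‖T x‖) : IsEssScalar S α := by
  obtain ⟨h1, h2⟩ := h
  constructor <;> simpa only [hTS]

theorem exists_mem_orthogonal_ne_zero (hH : ¬ FiniteDimensional ℂ H) (F : Submodule ℂ H)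
    [FiniteDimensional ℂ F] : ∃ x ∈ Fᗮ, x ≠ 0 := by
  by_contra! h
  have h1 : Fᗮ = ⊥ := (Submodule.eq_bot_iff _).2 h
  rw [Submodule.orthogonal_eq_bot_iff] at h1
  subst h1
  exact hH (Module.Finite.equiv (Submodule.topEquiv (R := ℂ) (M := H)))

theorem IsEssScalar.nonneg {T : H →L[ℂ] K} {α : ℝ} (h : IsEssScalar T α)
    (hH : ¬ FiniteDimensional ℂ H) : 0 ≤ α := by
  refine le_of_forall_pos_le_add fun ε hε => ?_
  obtain ⟨F, hF, h1⟩ := h.exists_ge ε hε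
  obtain ⟨x, hx, hx0⟩ := exists_mem_orthogonal_ne_zero hH F
  have h2 := h1 x hx
  have h3 : 0 < ‖x‖ ^ 2 := by positivity
  exact nonneg_of_mul_nonneg_left ((sq_nonneg _).trans h2) h3

/-- The kernel meets `Fᗮ` trivially, so the projection onto `F` is injective on it. -/
theorem finiteDimensional_ker_of_le {S : H →L[ℂ] K} {F : Submodule ℂ H} [FiniteDimensional ℂ F]
    {δ : ℝ} (hδ : 0 < δ) (h : ∀ x ∈ Fᗮ, δ * ‖x‖ ≤ ‖S x‖) : FiniteDimensional ℂ S.ker := by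
  let f : S.ker →ₗ[ℂ] F := (F.orthogonalProjectionOnto : H →ₗ[ℂ] F) ∘ₗ S.ker.subtype
  refine Module.Finite.of_injective f ?_
  rw [← LinearMap.ker_eq_bot, LinearMap.ker_eq_bot']
  intro x hx
  have hx' : (x : H) ∈ Fᗮ := Submodule.orthogonalProjectionOnto_eq_zero_iff.1 hx
  have h1 := h _ hx'
  have h2 : S (x : H) = 0 := x.2
  rw [h2, norm_zero] at h1
  have : ‖(x : H)‖ = 0 := le_antisymm (by nlinarith) (norm_nonneg _)
  exact Subtype.ext (norm_eq_zero.1 this)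

/-- The range is the closed subspace `S Fᗮ` plus the finite-dimensional `S F`. -/
theorem isClosed_range_of_le [CompleteSpace H] {S : H →L[ℂ] K} {F : Submodule ℂ H}
    [FiniteDimensional ℂ F] {δ : ℝ} (hδ : 0 < δ) (h : ∀ x ∈ Fᗮ, δ * ‖x‖ ≤ ‖S x‖) :
    IsClosed (Set.range S) := by
  let g : Fᗮ →L[ℂ] K := S ∘L Fᗮ.subtypeL
  have hg : AntilipschitzWith (Real.toNNReal δ⁻¹) g := by
    refine ContinuousLinearMap.antilipschitz_of_bound _ fun x => ?_
    rw [Real.coe_toNNReal _ (by positivity), inv_mul_eq_div, le_div_iff₀ hδ, mul_comm]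
    exact h _ x.2
  have h1 : IsClosed (g.range : Set K) := hg.isClosed_range g.uniformContinuous
  have h2 := Submodule.isClosed_sup_finiteDimensional g.range (F.map (S : H →ₗ[ℂ] K)) h1
  convert h2
  ext y
  simp only [Set.mem_range, SetLike.mem_coe, Submodule.mem_sup]
  constructor
  · rintro ⟨x, rfl⟩
    refine ⟨S (x - F.orthogonalProjectionOnto x), ⟨⟨_, F.sub_starProjection_mem_orthogonal x⟩, rfl⟩,
      S (F.orthogonalProjectionOnto x), ⟨_, (F.orthogonalProjectionOnto x).2, rfl⟩, ?_⟩
    rw [← map_add, sub_add_cancel]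
  · rintro ⟨_, ⟨x, rfl⟩, _, ⟨z, -, rfl⟩, rfl⟩
    exact ⟨x + z, map_add _ _ _⟩

theorem opNorm_sq_le_of_forall_norm_sq_le {T : H →L[ℂ] K} {c : ℝ} (hc : ∀ x, ‖T x‖ ^ 2 ≤ c * ‖x‖ ^ 2)
    (hH : Nontrivial H) : ‖T‖ ^ 2 ≤ c := by
  obtain ⟨x, hx⟩ := exists_ne (0 : H)
  have h0 : 0 ≤ c := nonneg_of_mul_nonneg_left ((sq_nonneg _).trans (hc x))
    (by positivity : 0 < ‖x‖ ^ 2)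
  have h1 : ‖T‖ ≤ √c := by
    refine T.opNorm_le_bound (Real.sqrt_nonneg _) fun y => ?_
    refine abs_le_of_sq_le_sq' ?_ (by positivity) |>.2
    rw [mul_pow, Real.sq_sqrt h0]
    exact hc y
  calc ‖T‖ ^ 2 ≤ √c ^ 2 := by gcongr
    _ = c := Real.sq_sqrt h0

theorem norm_apply_sq_le (T : H →L[ℂ] K) (x : H) : ‖T x‖ ^ 2 ≤ ‖T‖ ^ 2 * ‖x‖ ^ 2 := by
  rw [← mul_pow]
  gcongr
  exact T.le_opNorm x

theorem isNormAttaining_of_ne_zero {T : H →L[ℂ] K} {x : H} (hx : x ≠ 0)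
    (h : ‖T‖ ^ 2 * ‖x‖ ^ 2 ≤ ‖T x‖ ^ 2) : IsNormAttaining T := by
  have hx' : 0 < ‖x‖ := norm_pos_iff.2 hx
  have h1 : ‖T x‖ = ‖T‖ * ‖x‖ := by
    refine le_antisymm (T.le_opNorm x) ?_
    rw [← mul_pow] at h
    exact (abs_le_of_sq_le_sq' h (norm_nonneg _)).2
  refine ⟨((‖x‖⁻¹ : ℝ) : ℂ) • x, ?_, ?_⟩
  · rw [norm_smul, Complex.norm_real, norm_inv, norm_norm, inv_mul_cancel₀ hx'.ne']
  · rw [map_smul, norm_smul, Complex.norm_real, norm_inv, norm_norm, h1]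
    field_simp

/-- A maximising vector is a kernel vector of `S = ‖T‖ ^ 2 - T* T`. The gap `δ` makes `S` bounded
below on `Fᗮ`, so its range is closed; were `S` also injective, it would be bounded below
everywhere, which would push `‖T‖ ^ 2` strictly below itself. -/
theorem isNormAttaining_of_le_sub [CompleteSpace H] [CompleteSpace K] [Nontrivial H]
    {T : H →L[ℂ] K} {F : Submodule ℂ H} [FiniteDimensional ℂ F] {δ : ℝ} (hδ : 0 < δ)
    (h : ∀ x ∈ Fᗮ, ‖T x‖ ^ 2 ≤ (‖T‖ ^ 2 - δ) * ‖x‖ ^ 2) : IsNormAttaining T := by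
  rcases eq_or_ne T 0 with rfl | hT
  · obtain ⟨x, hx⟩ := exists_ne (0 : H)
    exact isNormAttaining_of_ne_zero hx (by simp)
  have hT' : 0 < ‖T‖ := norm_pos_iff.2 hT
  set β : ℝ := ‖T‖ ^ 2 with hβ
  have hβ0 : 0 < β := by positivity
  let S : H →L[ℂ] H := (β : ℂ) • ContinuousLinearMap.id ℂ H - adjoint T ∘L T
  have hS : ∀ x, S x = (β : ℂ) • x - adjoint T (T x) := fun x => rfl
  have hre : ∀ x, RCLike.re ⟪adjoint T (T x), x⟫_ℂ = ‖T x‖ ^ 2 := fun x => by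
    rw [adjoint_inner_left]
    exact inner_self_eq_norm_sq (𝕜 := ℂ) _
  have hform : ∀ x, RCLike.re ⟪S x, x⟫_ℂ = β * ‖x‖ ^ 2 - ‖T x‖ ^ 2 := by
    intro x
    rw [hS, inner_sub_left, map_sub, hre, inner_smul_left, Complex.conj_ofReal]
    rw [show RCLike.re ((β : ℂ) * ⟪x, x⟫_ℂ) = β * RCLike.re ⟪x, x⟫_ℂ from
      Complex.re_ofReal_mul _ _, inner_self_eq_norm_sq]
  have hbelow : ∀ x ∈ Fᗮ, δ * ‖x‖ ≤ ‖S x‖ := by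
    intro x hx
    rcases eq_or_ne x 0 with rfl | hx0
    · simp
    have h1 : δ * ‖x‖ ^ 2 ≤ ‖S x‖ * ‖x‖ := by
      have := hform x
      have h2 := h x hx
      have h3 := re_inner_le_norm (𝕜 := ℂ) (S x) x
      nlinarith
    exact le_of_mul_le_mul_right (by nlinarith) (norm_pos_iff.2 hx0)
  by_cases hinj : Function.Injective S
  · exfalso
    obtain ⟨C, hC0, hC⟩ : ∃ C : ℝ, 0 < C ∧ ∀ x, ‖x‖ ≤ C * ‖S x‖ := by
      obtain ⟨C, hC⟩ := S.antilipschitz_of_injective_of_isClosed_range hinj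
        (isClosed_range_of_le hδ hbelow)
      refine ⟨C + 1, by positivity, fun x => (S.bound_of_antilipschitz hC x).trans ?_⟩
      gcongr
      simp
    -- This is `‖S x‖ ^ 2 ≤ β * re ⟪S x, x⟫`, valid because `0 ≤ S ≤ β`; it turns a lower bound on
    -- `‖S x‖` into one on the form.
    have hupper : ∀ x, ‖S x‖ ^ 2 ≤ β * (β * ‖x‖ ^ 2 - ‖T x‖ ^ 2) := by
      intro x
      have h1 : ‖S x‖ ^ 2 = β ^ 2 * ‖x‖ ^ 2 - 2 * (β * ‖T x‖ ^ 2) + ‖adjoint T (T x)‖ ^ 2 := by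
        rw [hS, norm_sub_sq (𝕜 := ℂ), inner_smul_left, Complex.conj_ofReal,
          show RCLike.re ((β : ℂ) * ⟪x, adjoint T (T x)⟫_ℂ)
            = β * RCLike.re ⟪x, adjoint T (T x)⟫_ℂ from Complex.re_ofReal_mul _ _,
          inner_re_symm, hre, norm_smul, Complex.norm_real, mul_pow, Real.norm_eq_abs, sq_abs]
      have h2 : ‖adjoint T (T x)‖ ^ 2 ≤ β * ‖T x‖ ^ 2 := by
        have := norm_apply_sq_le (adjoint T) (T x)
        rwa [LinearIsometryEquiv.norm_map] at this
      nlinarith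
    have h3 : β ≤ β - (β * C ^ 2)⁻¹ := by
      refine opNorm_sq_le_of_forall_norm_sq_le (fun x => ?_) inferInstance
      have h4 : ‖x‖ ^ 2 ≤ C ^ 2 * ‖S x‖ ^ 2 := by
        rw [← mul_pow]
        gcongr
        exact hC x
      have h5 : ‖x‖ ^ 2 ≤ (β * ‖x‖ ^ 2 - ‖T x‖ ^ 2) * (β * C ^ 2) := by
        have := mul_le_mul_of_nonneg_left (hupper x) (sq_nonneg C)
        nlinarith
      have h6 := (div_le_iff₀ (by positivity)).2 h5
      rw [div_eq_inv_mul] at h6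
      linarith
    have : 0 < (β * C ^ 2)⁻¹ := by positivity
    linarith
  · obtain ⟨x, hx0, hx⟩ : ∃ x, x ≠ 0 ∧ S x = 0 := by
      by_contra! hne
      exact hinj ((injective_iff_map_eq_zero S).2 fun x hx => by_contra fun h0 => hne x h0 hx)
    refine isNormAttaining_of_ne_zero hx0 ?_
    have := hform x
    rw [hx, inner_zero_left, map_zero] at this
    linarith

/-- If `α < ‖T‖ ^ 2`, the form has a gap below `‖T‖ ^ 2` on a subspace of finite codimension.
Otherwise every nonzero vector of the `Fᗮ` from `exists_le` is maximising; if there is none, the gap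
condition holds vacuously. -/
theorem IsEssScalar.isNormAttaining [CompleteSpace H] [CompleteSpace K] [Nontrivial H]
    {T : H →L[ℂ] K} {α : ℝ} (h : IsEssScalar T α) : IsNormAttaining T := by
  rcases lt_or_ge α (‖T‖ ^ 2) with hlt | hge
  · obtain ⟨F, hF, h1⟩ := h.exists_ge ((‖T‖ ^ 2 - α) / 2) (by linarith)
    refine isNormAttaining_of_le_sub (F := F) (δ := (‖T‖ ^ 2 - α) / 2) (by linarith) fun x hx => ?_
    convert h1 x hx using 2
    ring
  · obtain ⟨F, hF, h1⟩ := h.exists_le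
    by_cases hne : ∃ x ∈ Fᗮ, x ≠ 0
    · obtain ⟨x, hx, hx0⟩ := hne
      refine isNormAttaining_of_ne_zero hx0 (le_trans ?_ (h1 x hx))
      gcongr
    · push Not at hne
      refine isNormAttaining_of_le_sub (F := F) one_pos fun x hx => ?_
      simp [hne x hx]

theorem IsEssScalar.isAN [CompleteSpace H] [CompleteSpace K] {T : H →L[ℂ] K} {α : ℝ}
    (h : IsEssScalar T α) : IsAN T := by
  intro M hM hM0
  have : CompleteSpace M := hM.completeSpace_coe
  have : Nontrivial M := Submodule.nontrivial_iff_ne_bot.2 hM0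
  exact (h.comp_isometry M.subtypeL fun x => rfl).isNormAttaining

/-- On the closed span, `‖T z‖ ^ 2` is the average of the `‖T (x n)‖ ^ 2` with weights `‖c n‖ ^ 2`.
A maximum would strictly exceed every one of them, so all weights would vanish. -/
theorem not_isAN_of_strictMono [CompleteSpace H] {T : H →L[ℂ] K} {x : ℕ → H}
    (hx : ∀ n, ‖x n‖ = 1) (hxx : Pairwise fun m n => ⟪x m, x n⟫_ℂ = 0)
    (hTx : Pairwise fun m n => ⟪T (x m), T (x n)⟫_ℂ = 0)
    (hmono : ∀ n, ‖T (x n)‖ ^ 2 < ‖T (x (n + 1))‖ ^ 2) : ¬ IsAN T := by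
  intro hT
  have hv : Orthonormal ℂ x := ⟨hx, hxx⟩
  let J := hv.orthogonalFamily.linearIsometry
  let M : Submodule ℂ H := LinearMap.range J.toLinearMap
  have hM : IsClosed (M : Set H) := J.isometry.isClosedEmbedding.isClosed_range
  have hxM : ∀ n, x n ∈ M := fun n =>
    ⟨lp.single 2 n (1 : ℂ), by
      classical
      have := hv.orthogonalFamily.linearIsometry_apply_single (i := n) (1 : ℂ)
      refine this.trans ?_
      simp⟩
  have hM0 : M ≠ ⊥ := fun h => by
    have h1 := hxM 0
    rw [h, Submodule.mem_bot] at h1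
    simpa [h1] using hx 0
  obtain ⟨⟨z, c, hc⟩, hz1, hz⟩ := hT M hM hM0
  have hzsum : HasSum (fun n => c n • x n) z := by
    have := hv.orthogonalFamily.hasSum_linearIsometry c
    rw [← hc]
    exact this
  have hz1' : ‖z‖ = 1 := hz1
  have hz' : ‖T z‖ = ‖T ∘L M.subtypeL‖ := hz
  have hle : ∀ n, ‖T (x n)‖ ^ 2 ≤ ‖T z‖ ^ 2 := by
    intro n
    have := norm_apply_sq_le (T ∘L M.subtypeL) ⟨x n, hxM n⟩
    rw [hz']
    simpa [hx n] using this
  have h1 := hasSum_norm_sq_of_pairwise_orthogonal hxx hzsum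
  have h2 : HasSum (fun n => ‖c n‖ ^ 2 * ‖T (x n)‖ ^ 2) (‖T z‖ ^ 2) := by
    refine hasSum_norm_sq_of_pairwise_orthogonal hTx ?_
    simpa using hzsum.mapL T
  have h3 := (h1.mul_left (‖T z‖ ^ 2)).sub h2
  have h4 : ∀ n, c n = 0 := by
    have hnn : ∀ n, 0 ≤ ‖T z‖ ^ 2 * (‖c n‖ ^ 2 * ‖x n‖ ^ 2) - ‖c n‖ ^ 2 * ‖T (x n)‖ ^ 2 := by
      intro n
      have := mul_le_mul_of_nonneg_left (hle n) (sq_nonneg ‖c n‖)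
      rw [hx n]
      linarith
    rw [hz1', one_pow, mul_one, sub_self] at h3
    have h5 := (hasSum_zero_iff_of_nonneg hnn).1 h3
    intro n
    have h6 := congrFun h5 n
    have h7 := (hmono n).trans_le (hle (n + 1))
    simp only [hx n, Pi.zero_apply] at h6
    have h8 : ‖c n‖ ^ 2 * (‖T z‖ ^ 2 - ‖T (x n)‖ ^ 2) = 0 := by linarith
    rcases mul_eq_zero.1 h8 with h9 | h9
    · simpa using h9
    · linarith
  simp only [h4, norm_zero, hz1'] at h1
  have h9 : (fun n => (0 : ℝ) ^ 2 * ‖x n‖ ^ 2) = fun _ => 0 := by simp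
  rw [h9] at h1
  simpa using h1.unique hasSum_zero

/-- Intermediate values of the Rayleigh quotient of `T* T` on a subspace. -/
theorem exists_mem_norm_sq_between {T : H →L[ℂ] K} {N : Submodule ℂ H} {c d : ℝ} (hcd : c < d)
    (hlow : ∃ x ∈ N, ‖T x‖ ^ 2 < d * ‖x‖ ^ 2) (hhigh : ∃ y ∈ N, c * ‖y‖ ^ 2 < ‖T y‖ ^ 2) :
    ∃ z ∈ N, ‖z‖ = 1 ∧ c < ‖T z‖ ^ 2 ∧ ‖T z‖ ^ 2 < d := by
  suffices ∃ z ∈ N, c * ‖z‖ ^ 2 < ‖T z‖ ^ 2 ∧ ‖T z‖ ^ 2 < d * ‖z‖ ^ 2 by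
    obtain ⟨z, hz, h1, h2⟩ := this
    have hz0 : z ≠ 0 := by
      rintro rfl
      simp at h1
    have hz' : 0 < ‖z‖ ^ 2 := by positivity
    refine ⟨((‖z‖⁻¹ : ℝ) : ℂ) • z, N.smul_mem _ hz, ?_, ?_⟩
    · rw [norm_smul, Complex.norm_real, norm_inv, norm_norm, inv_mul_cancel₀ (by simpa using hz0)]
    · rw [map_smul, norm_smul, Complex.norm_real, norm_inv, norm_norm, mul_pow, inv_pow,
        inv_mul_eq_div]
      exact ⟨(lt_div_iff₀ hz').2 h1, (div_lt_iff₀ hz').2 h2⟩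
  obtain ⟨x, hx, hxd⟩ := hlow
  obtain ⟨y, hy, hyc⟩ := hhigh
  by_cases hxc : c * ‖x‖ ^ 2 < ‖T x‖ ^ 2
  · exact ⟨x, hx, hxc, hxd⟩
  by_cases hyd : ‖T y‖ ^ 2 < d * ‖y‖ ^ 2
  · exact ⟨y, hy, hyc, hyd⟩
  push Not at hxc hyd
  let m := (c + d) / 2
  have hcm : c < m := by simp only [m]; linarith
  have hmd : m < d := by simp only [m]; linarith
  have hx0 : x ≠ 0 := by
    rintro rfl
    simp at hxd
  have hy0 : y ≠ 0 := by
    rintro rfl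
    simp at hyc
  have hxp : 0 < ‖x‖ ^ 2 := by positivity
  have hyp : 0 < ‖y‖ ^ 2 := by positivity
  have hxm : ‖T x‖ ^ 2 < m * ‖x‖ ^ 2 := hxc.trans_lt (by gcongr)
  have hym : m * ‖y‖ ^ 2 < ‖T y‖ ^ 2 := lt_of_lt_of_le (by gcongr) hyd
  -- Along the segment from `x` to `y` the form `‖T ·‖ ^ 2 - m * ‖·‖ ^ 2` changes sign.
  let w : ℝ → H := fun t => ((1 - t : ℝ) : ℂ) • x + (t : ℂ) • y
  have hwc : Continuous w := by fun_prop
  let f : ℝ → ℝ := fun t => ‖T (w t)‖ ^ 2 - m * ‖w t‖ ^ 2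
  have hfc : Continuous f := by fun_prop
  have hf0 : f 0 < 0 := by simpa [f, w] using hxm
  have hf1 : 0 < f 1 := by simpa [f, w] using hym
  obtain ⟨t, -, ht⟩ := intermediate_value_Icc zero_le_one hfc.continuousOn
    (⟨hf0.le, hf1.le⟩ : (0 : ℝ) ∈ Set.Icc (f 0) (f 1))
  have hw : T (w t) = ((1 - t : ℝ) : ℂ) • T x + (t : ℂ) • T y := by simp [w]
  -- If the segment met `0`, then `x` and `y` would be proportional with equal Rayleigh quotients,
  -- but these lie on opposite sides of `m`.
  have hwt0 : w t ≠ 0 := by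
    intro h0
    have h1 : ((1 - t : ℝ) : ℂ) • x = -((t : ℂ) • y) := eq_neg_of_add_eq_zero_left h0
    have h2 : ((1 - t : ℝ) : ℂ) • T x = -((t : ℂ) • T y) := by
      rw [← map_smul, h1, map_neg, map_smul]
    have h3 : (1 - t) ^ 2 * ‖x‖ ^ 2 = t ^ 2 * ‖y‖ ^ 2 := by
      have := congrArg (fun v => ‖v‖ ^ 2) h1
      simpa [norm_smul, mul_pow, -Complex.ofReal_sub] using this
    have h4 : (1 - t) ^ 2 * ‖T x‖ ^ 2 = t ^ 2 * ‖T y‖ ^ 2 := by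
      have := congrArg (fun v => ‖v‖ ^ 2) h2
      simpa [norm_smul, mul_pow, -Complex.ofReal_sub] using this
    rcases eq_or_ne t 0 with rfl | ht0
    · simp only [sub_zero, one_pow, one_mul, ne_eq, OfNat.ofNat_ne_zero, not_false_eq_true,
        zero_pow, zero_mul] at h3
      exact hxp.ne' h3
    · have h5 : 0 < t ^ 2 := by positivity
      nlinarith [mul_lt_mul_of_pos_left hym h5,
        mul_le_mul_of_nonneg_left hxm.le (sq_nonneg (1 - t))]
  have hwp : 0 < ‖w t‖ ^ 2 := by positivity
  have hft : ‖T (w t)‖ ^ 2 = m * ‖w t‖ ^ 2 := sub_eq_zero.1 ht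
  refine ⟨w t, N.add_mem (N.smul_mem _ hx) (N.smul_mem _ hy), ?_, ?_⟩
  · rw [hft]; gcongr
  · rw [hft]; gcongr

theorem not_isAN_of_forall_exists_lt [CompleteSpace H] [CompleteSpace K] {T : H →L[ℂ] K} {α : ℝ}
    (hlow : ∀ F : Submodule ℂ H, FiniteDimensional ℂ F → ∃ x ∈ Fᗮ, ‖T x‖ ^ 2 < α * ‖x‖ ^ 2)
    (hhigh : ∀ c < α, ∀ F : Submodule ℂ H, FiniteDimensional ℂ F →
      ∃ x ∈ Fᗮ, c * ‖x‖ ^ 2 < ‖T x‖ ^ 2) : ¬ IsAN T := by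
  obtain ⟨x, hx, hr⟩ := exists_seq_of_forall_finset_exists
    (fun x : H => ‖x‖ = 1 ∧ ‖T x‖ ^ 2 < α)
    (fun x y => ⟪x, y⟫_ℂ = 0 ∧ ⟪T x, T y⟫_ℂ = 0 ∧ ‖T x‖ ^ 2 < ‖T y‖ ^ 2) (by
      intro s hs
      obtain ⟨c, hcα, hc⟩ : ∃ c < α, ∀ x ∈ s, ‖T x‖ ^ 2 ≤ c := by
        rcases s.eq_empty_or_nonempty with rfl | hne
        · exact ⟨α - 1, by linarith, by simp⟩
        · obtain ⟨x, hxs, hxm⟩ := s.exists_max_image (fun x => ‖T x‖ ^ 2) hne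
          exact ⟨_, (hs x hxs).2, hxm⟩
      let F : Submodule ℂ H := Submodule.span ℂ (s : Set H)
      -- Orthogonality to `F` gives `z ⊥ x`; orthogonality to `T* T F` gives `T z ⊥ T x`.
      let G : Submodule ℂ H := F ⊔ F.map (adjoint T ∘L T : H →L[ℂ] H).toLinearMap
      have hF : FiniteDimensional ℂ F := FiniteDimensional.span_finset ℂ s
      obtain ⟨z, hz, hz1, hcz, hzα⟩ := exists_mem_norm_sq_between hcα
        (hlow G inferInstance) (hhigh c hcα G inferInstance)
      refine ⟨z, ⟨hz1, hzα⟩, fun x hxs => ?_⟩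
      have hxF : x ∈ F := Submodule.subset_span hxs
      refine ⟨hz x (Submodule.mem_sup_left hxF), ?_, (hc x hxs).trans_lt hcz⟩
      rw [← adjoint_inner_left]
      exact hz _ (Submodule.mem_sup_right ⟨x, hxF, rfl⟩))
  refine not_isAN_of_strictMono (fun n => (hx n).1) (fun m n hmn => ?_) (fun m n hmn => ?_)
    fun n => (hr n (n + 1) n.lt_succ_self).2.2
  · rcases hmn.lt_or_gt with h | h
    · exact (hr m n h).1
    · exact inner_eq_zero_symm.1 (hr n m h).1
  · rcases hmn.lt_or_gt with h | h
    · exact (hr m n h).2.1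
    · exact inner_eq_zero_symm.1 (hr n m h).2.1

theorem IsAN.exists_isEssScalar [CompleteSpace H] [CompleteSpace K] {T : H →L[ℂ] K}
    (hT : IsAN T) : ∃ α, IsEssScalar T α := by
  let s : Set ℝ := {c | 0 ≤ c ∧ ∃ F : Submodule ℂ H, FiniteDimensional ℂ F ∧
    ∀ x ∈ Fᗮ, ‖T x‖ ^ 2 ≤ c * ‖x‖ ^ 2}
  have hs : s.Nonempty := ⟨‖T‖ ^ 2, sq_nonneg _, ⊥, inferInstance, fun x _ => norm_apply_sq_le T x⟩
  have hb : BddBelow s := ⟨0, fun c hc => hc.1⟩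
  refine ⟨sInf s, ?_, fun ε hε => ?_⟩
  · by_contra! hlow
    refine not_isAN_of_forall_exists_lt hlow (fun c hc F hF => ?_) hT
    -- Elements of `s` are nonnegative by definition, so the infimum says nothing about negative
    -- `c`; there any nonzero vector of `Fᗮ` works.
    rcases lt_or_ge c 0 with hc0 | hc0
    · obtain ⟨x, hx, hlt⟩ := hlow F hF
      have hx0 : x ≠ 0 := by
        rintro rfl
        simp at hlt
      refine ⟨x, hx, lt_of_lt_of_le ?_ (sq_nonneg _)⟩
      exact mul_neg_of_neg_of_pos hc0 (by positivity)
    · by_contra! hle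
      exact (csInf_le hb ⟨hc0, F, hF, hle⟩).not_gt hc
  · obtain ⟨c, ⟨-, F, hF, h⟩, hc⟩ := exists_lt_of_csInf_lt hs (lt_add_of_pos_right (sInf s) hε)
    refine ⟨F, hF, fun x hx => (h x hx).trans ?_⟩
    gcongr

end EssScalar

/-! ### The essential spectrum of the modulus. -/

section Modulus

variable {H K : Type*}
  [NormedAddCommGroup H] [InnerProductSpace ℂ H] [CompleteSpace H]
  [NormedAddCommGroup K] [InnerProductSpace ℂ K] [CompleteSpace K]

theorem adjoint_modulus (T : H →L[ℂ] K) : adjoint (modulus T) = modulus T :=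
  ((nonneg_iff_isPositive _).1 (modulus_nonneg T)).isSelfAdjoint

theorem norm_modulus_apply (T : H →L[ℂ] K) (x : H) : ‖modulus T x‖ = ‖T x‖ := by
  have h1 : ⟪modulus T x, modulus T x⟫_ℂ = ⟪T x, T x⟫_ℂ := by
    rw [← adjoint_inner_left, adjoint_modulus, ← adjoint_inner_left T]
    exact congrArg (fun f : H →L[ℂ] H => ⟪f x, x⟫_ℂ) (modulus_comp_modulus T)
  rw [inner_self_eq_norm_sq_to_K, inner_self_eq_norm_sq_to_K] at h1
  have h2 : ‖modulus T x‖ ^ 2 = ‖T x‖ ^ 2 := by exact_mod_cast h1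
  exact (sq_eq_sq₀ (norm_nonneg _) (norm_nonneg _)).1 h2

/-- A symmetric operator whose quadratic form is small on a subspace is small on the vectors which
it keeps in that subspace. -/
theorem norm_apply_le_of_abs_re_inner_le {D : H →L[ℂ] H} (hD : adjoint D = D) {N : Submodule ℂ H}
    {ε : ℝ} (hε : 0 < ε) (h : ∀ x ∈ N, |RCLike.re ⟪D x, x⟫_ℂ| ≤ ε * ‖x‖ ^ 2) {x : H} (hx : x ∈ N)
    (hDx : D x ∈ N) : ‖D x‖ ≤ ε * ‖x‖ := by
  -- Polarisation on `x ± y`: with this scaling the bound becomes `4 * ‖D x‖ ^ 2 ≤ 2 * (ε * ‖x‖) ^ 2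
  -- + 2 * ‖D x‖ ^ 2`, and the last term is absorbed.
  let y : H := ((ε⁻¹ : ℝ) : ℂ) • D x
  have hy : y ∈ N := N.smul_mem _ hDx
  have hxy : RCLike.re ⟪D x, y⟫_ℂ = ε⁻¹ * ‖D x‖ ^ 2 := by
    rw [inner_smul_right, ← inner_self_eq_norm_sq (𝕜 := ℂ)]
    exact Complex.re_ofReal_mul _ _
  have hyx : RCLike.re ⟪D y, x⟫_ℂ = ε⁻¹ * ‖D x‖ ^ 2 := by
    rw [← hxy, ← adjoint_inner_right, hD, inner_re_symm]
  have hny : ‖y‖ ^ 2 = (ε⁻¹) ^ 2 * ‖D x‖ ^ 2 := by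
    rw [norm_smul, Complex.norm_real, mul_pow, Real.norm_eq_abs, sq_abs]
  have h1 := (abs_le.1 (h _ (N.add_mem hx hy))).2
  have h2 := (abs_le.1 (h _ (N.sub_mem hx hy))).1
  have h3 := parallelogram_law_with_norm ℂ x y
  simp only [map_add, map_sub, inner_add_left, inner_add_right, inner_sub_left, inner_sub_right,
    hxy, hyx] at h1 h2
  have h4 : ‖x + y‖ ^ 2 + ‖x - y‖ ^ 2 = 2 * (‖x‖ ^ 2 + (ε⁻¹) ^ 2 * ‖D x‖ ^ 2) := by
    rw [← hny]
    linarith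
  have h5 : 4 * (ε⁻¹ * ‖D x‖ ^ 2) ≤ ε * (2 * (‖x‖ ^ 2 + (ε⁻¹) ^ 2 * ‖D x‖ ^ 2)) := by
    rw [← h4]
    linarith
  have h6 : ‖D x‖ ^ 2 ≤ (ε * ‖x‖) ^ 2 := by
    have h7 := mul_le_mul_of_nonneg_left h5 hε.le
    have h8 : ε * (4 * (ε⁻¹ * ‖D x‖ ^ 2)) = 4 * ‖D x‖ ^ 2 := by field_simp
    have h9 : ε * (ε * (2 * (‖x‖ ^ 2 + (ε⁻¹) ^ 2 * ‖D x‖ ^ 2)))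
        = 2 * (ε * ‖x‖) ^ 2 + 2 * ‖D x‖ ^ 2 := by field_simp
    linarith
  exact (abs_le_of_sq_le_sq' h6 (by positivity)).2

/-- Factor `D = S ^ 2 - a ^ 2 = (S + a) R` with `R = S - a`. Since `S` and `a` are nonnegative, `‖R
y‖ ≤ ‖(S + a) y‖`, so `‖R x‖ ^ 2 ≤ ‖R (R x)‖ * ‖x‖ ≤ ‖D x‖ * ‖x‖`. This square root explains the use
of `ε ^ 2` for `D`. -/
theorem IsEssScalar.exists_norm_sub_le {S : H →L[ℂ] H} (hS : S.IsPositive) {a : ℝ} (ha : 0 ≤ a)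
    (h : IsEssScalar S (a ^ 2)) {ε : ℝ} (hε : 0 < ε) : ∃ F : Submodule ℂ H,
      FiniteDimensional ℂ F ∧ ∀ x ∈ Fᗮ, ‖S x - (a : ℂ) • x‖ ≤ ε * ‖x‖ := by
  have hSa : adjoint S = S := hS.isSelfAdjoint
  let R : H →L[ℂ] H := S - (a : ℂ) • ContinuousLinearMap.id ℂ H
  have hR : ∀ x, R x = S x - (a : ℂ) • x := fun x => rfl
  have hRa : adjoint R = R := by
    refine (eq_adjoint_iff R R).2 (fun x y => ?_) |>.symm
    rw [hR, hR, inner_sub_left, inner_sub_right, inner_smul_left, inner_smul_right,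
      Complex.conj_ofReal, ← adjoint_inner_right, hSa]
  let D : H →L[ℂ] H := S ∘L S - ((a ^ 2 : ℝ) : ℂ) • ContinuousLinearMap.id ℂ H
  have hD : ∀ x, D x = S (S x) - ((a ^ 2 : ℝ) : ℂ) • x := fun x => rfl
  have hDa : adjoint D = D := by
    refine (eq_adjoint_iff D D).2 (fun x y => ?_) |>.symm
    rw [hD, hD, inner_sub_left, inner_sub_right, inner_smul_left, inner_smul_right,
      Complex.conj_ofReal, ← adjoint_inner_right, hSa, ← adjoint_inner_right, hSa]
  have hform : ∀ x, RCLike.re ⟪D x, x⟫_ℂ = ‖S x‖ ^ 2 - a ^ 2 * ‖x‖ ^ 2 := by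
    intro x
    rw [hD, inner_sub_left, map_sub, inner_smul_left, Complex.conj_ofReal,
      show RCLike.re (((a ^ 2 : ℝ) : ℂ) * ⟪x, x⟫_ℂ) = a ^ 2 * RCLike.re ⟪x, x⟫_ℂ from
      Complex.re_ofReal_mul _ _, inner_self_eq_norm_sq, ← adjoint_inner_right, hSa,
      inner_self_eq_norm_sq]
  obtain ⟨F₁, hF₁, h1⟩ := h.exists_le
  obtain ⟨F₂, hF₂, h2⟩ := h.exists_ge (ε ^ 2) (by positivity)
  let F : Submodule ℂ H := F₁ ⊔ F₂
  -- Adding `D* F` ensures that `D x` stays in `Fᗮ`, as `norm_apply_le_of_abs_re_inner_le` requires.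
  refine ⟨F ⊔ F.map (adjoint D : H →ₗ[ℂ] H), inferInstance, fun x hx => ?_⟩
  rw [← Submodule.inf_orthogonal] at hx
  have hDx : D x ∈ Fᗮ := mem_orthogonal_map_adjoint D F hx.2
  have hsmall : ‖D x‖ ≤ ε ^ 2 * ‖x‖ := by
    refine norm_apply_le_of_abs_re_inner_le hDa (N := Fᗮ) (by positivity) (fun y hy => ?_) hx.1 hDx
    rw [← Submodule.inf_orthogonal] at hy
    have h3 := h1 y hy.1
    have h4 := h2 y hy.2
    rw [hform, abs_le]
    constructor
    · nlinarith [sq_nonneg ε, sq_nonneg ‖y‖, mul_nonneg (sq_nonneg ε) (sq_nonneg ‖y‖)]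
    · linarith
  have hRR : ∀ y, ‖R y‖ ≤ ‖S y + (a : ℂ) • y‖ := by
    intro y
    have h3 : 0 ≤ RCLike.re ⟪S y, (a : ℂ) • y⟫_ℂ := by
      rw [inner_smul_right, show RCLike.re ((a : ℂ) * ⟪S y, y⟫_ℂ) = a * RCLike.re ⟪S y, y⟫_ℂ from
        Complex.re_ofReal_mul _ _]
      exact mul_nonneg ha (hS.re_inner_nonneg_left y)
    refine (abs_le_of_sq_le_sq' ?_ (norm_nonneg _)).2
    rw [hR, norm_sub_sq (𝕜 := ℂ), norm_add_sq (𝕜 := ℂ)]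
    linarith
  have hRD : S (R x) + (a : ℂ) • R x = D x := by
    rw [hR, hD, map_sub, map_smul, smul_sub, smul_smul]
    push_cast
    rw [sq]
    abel
  have h5 : ‖R x‖ ^ 2 ≤ (ε * ‖x‖) ^ 2 :=
    calc ‖R x‖ ^ 2 = RCLike.re ⟪R (R x), x⟫_ℂ := by
          rw [← adjoint_inner_right, hRa, inner_self_eq_norm_sq]
      _ ≤ ‖R (R x)‖ * ‖x‖ := re_inner_le_norm _ _
      _ ≤ ‖D x‖ * ‖x‖ := by
          gcongr
          rw [← hRD]
          exact hRR _
      _ ≤ (ε ^ 2 * ‖x‖) * ‖x‖ := by gcongr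
      _ = (ε * ‖x‖) ^ 2 := by ring
  exact (abs_le_of_sq_le_sq' h5 (by positivity)).2

/-- Where `S` is within `‖ν - a‖ / 2` of `a`, the operator `S - ν` is bounded below. As `a` is real,
this applies to `μ` and to its conjugate, hence to the operator and its adjoint. -/
theorem isFredholm_sub_smul_of_ne {S : H →L[ℂ] H} (hS : adjoint S = S) {a : ℝ}
    (h : ∀ ε > 0, ∃ F : Submodule ℂ H, FiniteDimensional ℂ F ∧
      ∀ x ∈ Fᗮ, ‖S x - (a : ℂ) • x‖ ≤ ε * ‖x‖) {μ : ℂ} (hμ : μ ≠ a) :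
    (S - μ • ContinuousLinearMap.id ℂ H).IsFredholm := by
  have key : ∀ ν : ℂ, ν ≠ a → ∃ δ > 0, ∃ F : Submodule ℂ H, FiniteDimensional ℂ F ∧
      ∀ x ∈ Fᗮ, δ * ‖x‖ ≤ ‖(S - ν • ContinuousLinearMap.id ℂ H) x‖ := by
    intro ν hν
    have hpos : 0 < ‖ν - a‖ := norm_pos_iff.2 (sub_ne_zero.2 hν)
    obtain ⟨F, hF, hFx⟩ := h (‖ν - a‖ / 2) (by positivity)
    refine ⟨‖ν - a‖ / 2, by positivity, F, hF, fun x hx => ?_⟩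
    have h1 : (ν - a) • x = (S x - (a : ℂ) • x) - (S - ν • ContinuousLinearMap.id ℂ H) x := by
      change _ = (S x - (a : ℂ) • x) - (S x - ν • x)
      rw [sub_smul]
      abel
    have h2 := norm_sub_le (S x - (a : ℂ) • x) ((S - ν • ContinuousLinearMap.id ℂ H) x)
    rw [← h1, norm_smul] at h2
    linarith [hFx x hx]
  have hadj : adjoint (S - μ • ContinuousLinearMap.id ℂ H)
      = S - (starRingEnd ℂ μ) • ContinuousLinearMap.id ℂ H := by
    refine ((eq_adjoint_iff _ _).2 fun x y => ?_).symm
    change ⟪S x - (starRingEnd ℂ μ) • x, y⟫_ℂ = ⟪x, S y - μ • y⟫_ℂ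
    rw [inner_sub_left, inner_sub_right, inner_smul_left, inner_smul_right, Complex.conj_conj,
      ← adjoint_inner_right, hS]
  rw [isFredholm_iff, hadj]
  obtain ⟨δ, hδ, F, hF, hFx⟩ := key μ hμ
  obtain ⟨δ', hδ', F', hF', hFx'⟩ := key (starRingEnd ℂ μ) fun hc => hμ (by
    rw [← Complex.conj_conj μ, hc, Complex.conj_ofReal])
  exact ⟨isClosed_range_of_le hδ hFx, finiteDimensional_ker_of_le hδ hFx,
    finiteDimensional_ker_of_le hδ' hFx'⟩

/-- An operator with closed range and finite-dimensional kernel is not arbitrarily small on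
subspaces of finite codimension. -/
theorem not_isFredholm_of_forall_exists_le (hH : ¬ FiniteDimensional ℂ H) {R : H →L[ℂ] K}
    (h : ∀ ε > 0, ∃ F : Submodule ℂ H, FiniteDimensional ℂ F ∧ ∀ x ∈ Fᗮ, ‖R x‖ ≤ ε * ‖x‖) :
    ¬ R.IsFredholm := by
  intro hR
  rw [isFredholm_iff] at hR
  obtain ⟨hcl, hker, -⟩ := hR
  let g : R.kerᗮ →L[ℂ] K := R ∘L R.kerᗮ.subtypeL
  have hinj : Function.Injective g := by
    refine (injective_iff_map_eq_zero g).2 fun x hx => ?_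
    have h1 : (x : H) ∈ R.ker := hx
    exact Subtype.ext (inner_self_eq_zero.1 (x.2 _ h1))
  have hrange : Set.range g = Set.range R := by
    ext y
    constructor
    · rintro ⟨x, rfl⟩
      exact ⟨x, rfl⟩
    · rintro ⟨x, rfl⟩
      refine ⟨⟨_, R.ker.sub_starProjection_mem_orthogonal x⟩, ?_⟩
      change R (x - R.ker.orthogonalProjectionOnto x) = R x
      rw [map_sub, sub_eq_self]
      exact (R.ker.orthogonalProjectionOnto x).2
  obtain ⟨C, hC⟩ := g.antilipschitz_of_injective_of_isClosed_range hinj (hrange ▸ hcl)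
  have hbound := g.bound_of_antilipschitz hC
  -- With this `ε`, `(C + 1) * ‖R x‖ ≤ ‖x‖ ≤ C * ‖R x‖`, which forces `R x = 0` and then `x = 0`.
  obtain ⟨F, hF, hFx⟩ := h ((C : ℝ) + 1)⁻¹ (by positivity)
  obtain ⟨x, hx, hx0⟩ := exists_mem_orthogonal_ne_zero hH (F ⊔ R.ker)
  rw [← Submodule.inf_orthogonal] at hx
  have h1 : ‖x‖ ≤ C * ‖R x‖ := hbound ⟨x, hx.2⟩
  have h2 := hFx x hx.1
  have hxp : 0 < ‖x‖ := norm_pos_iff.2 hx0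
  rw [inv_mul_eq_div, le_div_iff₀ (by positivity)] at h2
  have h3 : ‖R x‖ = 0 := by nlinarith [norm_nonneg (R x)]
  rw [h3, mul_zero] at h1
  linarith

theorem IsEssScalar.essSpectrum_modulus (hH : ¬ FiniteDimensional ℂ H) {T : H →L[ℂ] K} {α : ℝ}
    (h : IsEssScalar T α) : essSpectrum (modulus T) = {((√α : ℝ) : ℂ)} := by
  have hS : IsEssScalar (modulus T) (√α ^ 2) := by
    rw [Real.sq_sqrt (h.nonneg hH)]
    exact h.congr_norm (norm_modulus_apply T)
  have hsmall := fun ε (hε : ε > 0) => hS.exists_norm_sub_le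
    ((nonneg_iff_isPositive _).1 (modulus_nonneg T)) (Real.sqrt_nonneg α) hε
  ext μ
  simp only [essSpectrum, Set.mem_ofPred_eq, Set.mem_singleton_iff]
  constructor
  · intro hμ
    by_contra hne
    exact hμ (isFredholm_sub_smul_of_ne (adjoint_modulus T) hsmall hne)
  · rintro rfl
    exact not_isFredholm_of_forall_exists_le hH hsmall

end Modulus

/-! ### The off-diagonal block operator. -/

section Block

variable {H₁ H₂ : Type*}
  [NormedAddCommGroup H₁] [InnerProductSpace ℂ H₁]
  [NormedAddCommGroup H₂] [InnerProductSpace ℂ H₂]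

theorem norm_sq_blockOperator_offDiagonal (A : H₂ →L[ℂ] H₁) (B : H₁ →L[ℂ] H₂)
    (z : WithLp 2 (H₁ × H₂)) : ‖blockOperator 0 A B 0 z‖ ^ 2 = ‖A z.snd‖ ^ 2 + ‖B z.fst‖ ^ 2 := by
  have h : blockOperator 0 A B 0 z = WithLp.toLp 2 (A z.snd, B z.fst) := by
    refine (blockOperator_apply 0 A B 0 z.fst z.snd).trans ?_
    simp
  rw [h, WithLp.prod_norm_sq_eq_of_L2]
  rfl

theorem IsEssScalar.of_blockOperator [CompleteSpace H₁] [CompleteSpace H₂] {A : H₂ →L[ℂ] H₁}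
    {B : H₁ →L[ℂ] H₂} {α : ℝ} (h : IsEssScalar (blockOperator 0 A B 0) α) :
    IsEssScalar A α ∧ IsEssScalar B α := by
  let e := (WithLp.prodContinuousLinearEquiv 2 ℂ H₁ H₂).symm.toContinuousLinearMap
  constructor
  · refine (h.comp_isometry (e ∘L ContinuousLinearMap.inr ℂ H₁ H₂) fun x => ?_).congr_norm
      fun x => ?_
    · exact WithLp.norm_toLp_snd (p := 2) H₁ H₂ x
    · refine ((sq_eq_sq₀ (norm_nonneg _) (norm_nonneg _)).1 ?_).symm
      refine (norm_sq_blockOperator_offDiagonal A B (WithLp.toLp 2 (0, x))).trans ?_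
      simp
  · refine (h.comp_isometry (e ∘L ContinuousLinearMap.inl ℂ H₁ H₂) fun x => ?_).congr_norm
      fun x => ?_
    · exact WithLp.norm_toLp_fst (p := 2) H₁ H₂ x
    · refine ((sq_eq_sq₀ (norm_nonneg _) (norm_nonneg _)).1 ?_).symm
      refine (norm_sq_blockOperator_offDiagonal A B (WithLp.toLp 2 (x, 0))).trans ?_
      simp

theorem exists_finiteDimensional_forall_orthogonal (F₁ : Submodule ℂ H₁) (F₂ : Submodule ℂ H₂)
    [FiniteDimensional ℂ F₁] [FiniteDimensional ℂ F₂] :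
    ∃ F : Submodule ℂ (WithLp 2 (H₁ × H₂)), FiniteDimensional ℂ F ∧
      ∀ z ∈ Fᗮ, z.fst ∈ F₁ᗮ ∧ z.snd ∈ F₂ᗮ := by
  let e := (WithLp.linearEquiv 2 ℂ (H₁ × H₂)).symm.toLinearMap
  refine ⟨F₁.map (e ∘ₗ LinearMap.inl ℂ H₁ H₂) ⊔ F₂.map (e ∘ₗ LinearMap.inr ℂ H₁ H₂),
    inferInstance, fun z hz => ⟨fun u hu => ?_, fun u hu => ?_⟩⟩
  · have := hz _ (Submodule.mem_sup_left (Submodule.mem_map_of_mem hu))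
    simpa [e, WithLp.prod_inner_apply] using this
  · have := hz _ (Submodule.mem_sup_right (Submodule.mem_map_of_mem hu))
    simpa [e, WithLp.prod_inner_apply] using this

theorem IsEssScalar.blockOperator {A : H₂ →L[ℂ] H₁} {B : H₁ →L[ℂ] H₂} {α : ℝ}
    (hA : IsEssScalar A α) (hB : IsEssScalar B α) :
    IsEssScalar (OffDiagonalAN.blockOperator 0 A B 0) α := by
  constructor
  · obtain ⟨F₁, hF₁, h1⟩ := hB.exists_le
    obtain ⟨F₂, hF₂, h2⟩ := hA.exists_le
    obtain ⟨F, hF, h⟩ := exists_finiteDimensional_forall_orthogonal F₁ F₂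
    refine ⟨F, hF, fun z hz => ?_⟩
    rw [norm_sq_blockOperator_offDiagonal, WithLp.prod_norm_sq_eq_of_L2]
    linarith [h1 _ (h z hz).1, h2 _ (h z hz).2]
  · intro ε hε
    obtain ⟨F₁, hF₁, h1⟩ := hB.exists_ge ε hε
    obtain ⟨F₂, hF₂, h2⟩ := hA.exists_ge ε hε
    obtain ⟨F, hF, h⟩ := exists_finiteDimensional_forall_orthogonal F₁ F₂
    refine ⟨F, hF, fun z hz => ?_⟩
    rw [norm_sq_blockOperator_offDiagonal, WithLp.prod_norm_sq_eq_of_L2]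
    linarith [h1 _ (h z hz).1, h2 _ (h z hz).2]

end Block

end OffDiagonalAN

end

theorem mainTheorem11 {H₁ H₂ : Type*}
    [NormedAddCommGroup H₁] [InnerProductSpace ℂ H₁] [CompleteSpace H₁]
    [TopologicalSpace.SeparableSpace H₁]
    [NormedAddCommGroup H₂] [InnerProductSpace ℂ H₂] [CompleteSpace H₂]
    [TopologicalSpace.SeparableSpace H₂]
    (hH₁ : ¬ FiniteDimensional ℂ H₁) (hH₂ : ¬ FiniteDimensional ℂ H₂)
    (A : H₂ →L[ℂ] H₁) (B : H₁ →L[ℂ] H₂) :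
    OffDiagonalAN.IsAN (OffDiagonalAN.blockOperator 0 A B 0) ↔
      OffDiagonalAN.IsAN A ∧ OffDiagonalAN.IsAN B ∧
        OffDiagonalAN.essSpectrum (OffDiagonalAN.modulus A) =
          OffDiagonalAN.essSpectrum (OffDiagonalAN.modulus B) := by
  constructor
  · intro h
    obtain ⟨α, hα⟩ := h.exists_isEssScalar
    obtain ⟨hA, hB⟩ := hα.of_blockOperator
    exact ⟨hA.isAN, hB.isAN, by rw [hA.essSpectrum_modulus hH₂, hB.essSpectrum_modulus hH₁]⟩
  · rintro ⟨hA, hB, hAB⟩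
    obtain ⟨α, hα⟩ := hA.exists_isEssScalar
    obtain ⟨β, hβ⟩ := hB.exists_isEssScalar
    -- Infinite dimension makes `α` and `β` nonnegative, so equal square roots give `α = β`.
    rw [hα.essSpectrum_modulus hH₂, hβ.essSpectrum_modulus hH₁, Set.singleton_eq_singleton_iff,
      Complex.ofReal_inj, Real.sqrt_inj (hα.nonneg hH₂) (hβ.nonneg hH₁)] at hAB
    subst hAB
    exact (hα.blockOperator hβ).isAN
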